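/- Let $X$ be a scheme of finite type over $\mathbb{Z}$. For a prime $p$ let $X_p = X\times_{\mathbb{Z}}\mathbb{F}_p$ and $$Z(X_p,t)=\exp\Big(\sum_{m\ge 1}\frac{\#X_p(\mathbb{F}_{p^m})}{m}\,t^m\Big),\qquad L(X,s)=\prod_p Z(X_p,p^{-s}).$$ Here $s$ is real, and $L(X,s)$ is said to converge at $s$ if all the series for $Z(X_p,p^{-s})$ converge and the product over $p$ converges (unconditionally). For an effective zero-cycle $\alpha=\sum_i n_i x_i$ on $X_p$ (a finite sum with $x_i$ closed points of $X_p$ and $n_i\in\mathbb{Z}_{\ge 0}$) put $\deg\alpha=\sum_i n_i[\kappa(x_i):\mathbb{F}_p]$, and let $H(X_p,t)=-\sum_\alpha t^{\deg\alpha}\log(t^{\deg\alpha})$. The global Hasse–Weil entropy $S(X)=S(X)(s)$ is the Shannon entropy $-\sum_\alpha P(\alpha)\log P(\alpha)$ of $$P(\alpha)=\prod_p\frac{p^{-s\deg\alpha_p}}{Z(X_p,p^{-s})}$$ on the families $\alpha=(\alpha_p)_p$ of effective zero-cycles $\alpha_p$ on $X_p$ with $\alpha_p=0$ for almost all $p$.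 Then $L(X,s)$ converges for all sufficiently large real $s$. Moreover, let $s$ be a real number such that $L(X,\sigma)$ converges for some real $\sigma<s$. Then $L(X,s)$ converges and is positive, $P$ is a probability distribution, all the series below and the series defining $S(X)$ converge absolutely, $u\mapsto\log L(X,u)$ is differentiable at $u=s$, and $$S(X)=\sum_p Z(X_p,p^{-s})^{-1}H(X_p,p^{-s})+\sum_p\log Z(X_p,p^{-s}),$$ $$S(X)=\log L(X,s)+s\sum_p\log(p)\sum_{m\ge 1}\#X_p(\mathbb{F}_{p^m})\,p^{-sm}.$$ The last term equals $-s\frac{d}{ds}\log L(X,s)$, so that $$S(X)=\Big(1-s\frac{d}{ds}\Big)\log L(X,s).$$ -/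

import Mathlib

open CategoryTheory CategoryTheory.Limits AlgebraicGeometry

namespace HasseWeil

noncomputable section

instance factPrimes (p : Nat.Primes) : Fact (p : ℕ).Prime := ⟨p.2⟩

/-- The Shannon entropy `-∑ P i log (P i)` of a distribution on a (possibly infinite) set. -/
def shannonEntropy {ι : Type*} (P : ι → ℝ) : ℝ := -∑' i, P i * Real.log (P i)

/-! ### Schemes over a prime field -/

/-- The `K`-valued points `Y(K)` of a scheme `g : Y ⟶ Spec k`: the morphisms
`Spec K ⟶ Y` over `Spec k`. -/
def Points {k : Type} [Field k] {Y : Scheme.{0}} (g : Y ⟶ Spec (.of k))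
    (K : Type) [Field K] [Algebra k K] : Type :=
  {φ : Spec (.of K) ⟶ Y // φ ≫ g = Spec.map (CommRingCat.ofHom (algebraMap k K))}

/-- The degree `[κ(y) : k]` of a point `y` of a scheme `g : Y ⟶ Spec k`, where `κ(y)` is a
`k`-algebra through the composite `Spec κ(y) ⟶ Y ⟶ Spec k`. -/
def pointDegree {k : Type} [Field k] {Y : Scheme.{0}} (g : Y ⟶ Spec (.of k)) (y : Y) : ℕ :=
  letI : Algebra k (Y.residueField y) :=
    (Spec.preimage (Y.fromSpecResidueField y ≫ g)).hom.toAlgebra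
  Module.finrank k (Y.residueField y)

/-- Effective zero-cycles on `Y`: finite formal sums `∑ nᵢ yᵢ` of closed points `yᵢ` with
coefficients `nᵢ ∈ ℕ`. -/
abbrev EffZeroCycle (Y : Scheme.{0}) : Type := (closedPoints Y) →₀ ℕ

/-- The degree `∑ nᵢ deg yᵢ` of the zero-cycle `∑ nᵢ yᵢ`. -/
def cycleDegree {k : Type} [Field k] {Y : Scheme.{0}} (g : Y ⟶ Spec (.of k))
    (α : EffZeroCycle Y) : ℕ :=
  α.sum fun y n => n * pointDegree g y.1

section PrimeField

variable {p : ℕ} [Fact p.Prime] {Y : Scheme.{0}} (g : Y ⟶ Spec (.of (ZMod p)))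

/-- The number `#Y(𝔽_{p^m})` of points. -/
def pointCount (m : ℕ) : ℕ := Nat.card (Points g (GaloisField p m))

/-- The general term `#Y(𝔽_{p^m}) / m * t^m`, `m ≥ 1`, of the series in the exponent of the zeta
function. -/
def logZetaTerm (t : ℝ) (m : ℕ+) : ℝ := (pointCount g m : ℝ) / (m : ℝ) * t ^ (m : ℕ)

/-- The Hasse--Weil zeta function `Z(Y, t) = exp (∑_{m ≥ 1} #Y(𝔽_{p^m}) / m * t^m)`. -/
def zeta (t : ℝ) : ℝ := Real.exp (∑' m : ℕ+, logZetaTerm g t m)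

/-- The general term of the information function `H(Y, t) = -∑_α t^{deg α} log (t^{deg α})`. -/
def infoTerm (t : ℝ) (α : EffZeroCycle Y) : ℝ :=
  -(t ^ cycleDegree g α * Real.log (t ^ cycleDegree g α))

/-- The information function `H(Y, t) = -∑_α t^{deg α} log (t^{deg α})`, the sum over all
effective zero-cycles. -/
def infoFun (t : ℝ) : ℝ := ∑' α : EffZeroCycle Y, infoTerm g t α

/-- The weight `P(α) = t^{deg α} / Z(Y, t)` of an effective zero-cycle `α`. -/
def localDist (t : ℝ) (α : EffZeroCycle Y) : ℝ := t ^ cycleDegree g α / zeta g t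

end PrimeField

/-! ### Schemes over the integers -/

section Integers

variable {X : Scheme.{0}} (f : X ⟶ Spec (.of ℤ))

/-- The reduction `X_p = X ×_{Spec ℤ} Spec 𝔽_p`. -/
def reduction (p : ℕ) : Scheme.{0} :=
  pullback f (Spec.map (CommRingCat.ofHom (Int.castRingHom (ZMod p))))

/-- The structure morphism `X_p ⟶ Spec 𝔽_p`. -/
def reductionMap (p : ℕ) : reduction f p ⟶ Spec (.of (ZMod p)) :=
  pullback.snd f (Spec.map (CommRingCat.ofHom (Int.castRingHom (ZMod p))))

/-- The local factor `Z(X_p, p^{-s})`. -/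
def localFactor (s : ℝ) (p : Nat.Primes) : ℝ := zeta (reductionMap f p) ((p : ℝ) ^ (-s))

/-- The `L`-function `L(X, s) = ∏_p Z(X_p, p^{-s})`. -/
def LFun (s : ℝ) : ℝ := ∏' p : Nat.Primes, localFactor f s p

/-- Convergence of `L(X, s)`: the series defining every local factor converges, and so does the
product of the local factors. -/
def LConverges (s : ℝ) : Prop :=
  (∀ p : Nat.Primes, Summable (logZetaTerm (reductionMap f p) ((p : ℝ) ^ (-s)))) ∧
    Multipliable (localFactor f s)

/-- The distribution `P(α) = ∏_p P(α_p)`, `P(α_p) = p^{-s deg α_p} / Z(X_p, p^{-s})`. It lives on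
the families `α = (α_p)_p` of effective zero-cycles `α_p` on `X_p` with `α_p = 0` for almost
all `p`. -/
def globalDist (s : ℝ) (α : Π₀ p : Nat.Primes, EffZeroCycle (reduction f p)) : ℝ :=
  ∏' p : Nat.Primes, localDist (reductionMap f p) ((p : ℝ) ^ (-s)) (α p)

/-- The global Hasse--Weil entropy: the Shannon entropy of the distribution `globalDist`. -/
def globalEntropy (s : ℝ) : ℝ := shannonEntropy (globalDist f s)

/-- The summand `Z(X_p, p^{-s})⁻¹ H(X_p, p^{-s})` of the global information function. -/
def localInfo (s : ℝ) (p : Nat.Primes) : ℝ :=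
  (localFactor f s p)⁻¹ * infoFun (reductionMap f p) ((p : ℝ) ^ (-s))

/-- The term `#X_p(𝔽_{p^m}) p^{-s m}`, `m ≥ 1`. -/
def ghostTerm (s : ℝ) (p : Nat.Primes) (m : ℕ+) : ℝ :=
  (pointCount (reductionMap f p) m : ℝ) * (p : ℝ) ^ (-s * (m : ℝ))

end Integers

end

end HasseWeil

/-!
Write `N x = p ^ deg x` for a closed point `x` of a reduction `X_p`. Everything is expressed through
the lengths `log N x`, which turn all the series into Dirichlet series with nonnegative terms.

* A point of `X_p` with values in `𝔽_{p^m}` is a closed point `x` together with an embedding of its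
  residue field, and there are `deg x` embeddings if `deg x ∣ m` and none otherwise
  (`natCard_points`). Hence `log Z(X_p, p^{-s}) = ∑ N x ^ (-s k) / k`, the sum over `x` and `k ≥ 1`
  (`summable_and_tsum_logZetaTerm`), and likewise the series of the `#X_p(𝔽_{p^m}) p^{-s m}` is,
  times `log p`, minus its termwise derivative (`summable_and_tsum_ghostTerm`). Convergence of
  `L(X, s)` is summability of this family over all `p`, `x` and `k` (`lConverges_iff`).
* A covering by finitely many spectra of finitely generated rings bounds `#X_p(𝔽_{p^m})` by
  `C * p ^ (m * n)` (`exists_pointCount_bound`), whence convergence for `s > n + 1`.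
* Expanding the Euler product gives `L(X, s) = ∑ N α ^ (-s)` over families `α` of zero-cycles
  (`hasSum_exp_totalLength`), so that `P(α) = N α ^ (-s) / L(X, s)` has total mass `1`.
* To the right of a point of convergence, `∑ N α ^ (-s)` and `log L(X, s)` may both be
  differentiated termwise (`hasDerivAt_dirichlet`). Comparing the two derivatives computes the mean
  of `log N α` under `P` (`hasSum_totalLength_mul_exp`), which is all that the entropy requires,
  since `-log P(α) = s log N α + log L(X, s)`. The same comparison for a single `X_p` evaluates
  `H(X_p, p^{-s})`.
-/

namespace HasseWeil

noncomputable section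

/-! ### Points of schemes over a field and closed points -/

section PointsOverField

variable {k : Type} [Field k] {Y : Scheme.{0}} (g : Y ⟶ Spec (.of k))

/-- The `k`-algebra structure on the residue field of a point of a `k`-scheme, the one that
`pointDegree` refers to. -/
@[reducible] def residueAlgebra (y : Y) : Algebra k (Y.residueField y) :=
  (Spec.preimage (Y.fromSpecResidueField y ≫ g)).hom.toAlgebra

/-- The embeddings of the residue field `κ(y)` into `K` over `k`. -/
def ResidueEmbedding (K : Type) [Field K] [Algebra k K] (y : Y) : Type :=
  letI := residueAlgebra g y
  Y.residueField y →ₐ[k] K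

lemma specMap_residue_comp_iff (K : Type) [Field K] [Algebra k K] (y : Y)
    (ψ : Y.residueField y ⟶ .of K) :
    (Spec.map ψ ≫ Y.fromSpecResidueField y) ≫ g =
        Spec.map (CommRingCat.ofHom (algebraMap k K)) ↔
      ∀ c : k, ψ.hom (letI := residueAlgebra g y; algebraMap k (Y.residueField y) c) =
        algebraMap k K c := by
  rw [Category.assoc, ← Spec.map_preimage (Y.fromSpecResidueField y ≫ g), ← Spec.map_comp,
    Spec.map_inj]
  constructor
  · intro h c
    exact congr($(h).hom c)
  · intro h
    ext c
    exact h c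

/-- The morphism of rings underlying an embedding of `κ(y)` into `K`. -/
def ResidueEmbedding.hom {K : Type} [Field K] [Algebra k K] {y : Y} (a : ResidueEmbedding g K y) :
    Y.residueField y ⟶ .of K :=
  letI := residueAlgebra g y
  CommRingCat.ofHom (AlgHom.toRingHom (R := k) (A := Y.residueField y) (B := K) a)

lemma ResidueEmbedding.hom_algebraMap {K : Type} [Field K] [Algebra k K] {y : Y}
    (a : ResidueEmbedding g K y) (c : k) :
    (a.hom g).hom (let := residueAlgebra g y; algebraMap k (Y.residueField y) c) =
      algebraMap k K c :=
  letI := residueAlgebra g y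
  AlgHom.commutes (R := k) (A := Y.residueField y) (B := K) a c

/-- The `K`-valued point given by a point `y` and a `k`-embedding of `κ(y)` into `K`. -/
def pointOfEmbedding (K : Type) [Field K] [Algebra k K] (a : Σ y : Y, ResidueEmbedding g K y) :
    Points g K :=
  ⟨(Scheme.SpecToEquivOfField K Y).symm ⟨a.1, a.2.hom g⟩,
    (specMap_residue_comp_iff g K a.1 (a.2.hom g)).2 a.2.hom_algebraMap⟩

lemma pointOfEmbedding_bijective (K : Type) [Field K] [Algebra k K] :
    Function.Bijective (pointOfEmbedding g K) := by
  constructor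
  · rintro ⟨y, a⟩ ⟨z, b⟩ h
    have h1 := (Scheme.SpecToEquivOfField K Y).symm.injective congr($(h).1)
    obtain ⟨h2, h3⟩ := Sigma.mk.inj h1
    obtain rfl : y = z := h2
    have h4 := eq_of_heq h3
    congr 1
    let := residueAlgebra g y
    exact AlgHom.ext fun c => congr($(h4).hom c)
  · rintro ⟨φ, hφ⟩
    obtain ⟨⟨y, ψ⟩, rfl⟩ := (Scheme.SpecToEquivOfField K Y).symm.surjective φ
    let := residueAlgebra g y
    let a : ResidueEmbedding g K y :=
      { ψ.hom with commutes' := (specMap_residue_comp_iff g K y ψ).1 hφ }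
    exact ⟨⟨y, a⟩, rfl⟩

/-- The Nullstellensatz for schemes locally of finite type over a field: the closed points are the
points whose residue field is finite over `k`. -/
lemma residueField_finite_iff [LocallyOfFiniteType g] (y : Y) :
    (letI := residueAlgebra g y; Module.Finite k (Y.residueField y)) ↔ IsClosed {y} := by
  have : JacobsonSpace Y := LocallyOfFiniteType.jacobsonSpace g
  have key : (letI := residueAlgebra g y; Module.Finite k (Y.residueField y)) ↔
      IsFinite (Y.fromSpecResidueField y ≫ g) := by
    rw [← Spec.map_preimage (Y.fromSpecResidueField y ≫ g), IsFinite.SpecMap_iff]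
    rfl
  rw [key]
  constructor
  · intro h
    rw [isClosed_singleton_iff_locallyOfFiniteType]
    exact locallyOfFiniteType_of_comp _ g
  · intro h
    have := isClosed_singleton_iff_isClosedImmersion.mp h
    exact isFinite_iff_locallyOfFiniteType_of_jacobsonSpace.mpr inferInstance

lemma pointDegree_pos [LocallyOfFiniteType g] (y : closedPoints Y) : 0 < pointDegree g y.1 := by
  let := residueAlgebra g y.1
  have : Module.Finite k (Y.residueField y.1) := (residueField_finite_iff g y.1).2 y.2
  exact Module.finrank_pos (R := k) (M := Y.residueField y.1)

section FiniteField

variable (K : Type) [Field K] [Algebra k K] [Finite K]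

/-- A residue field of infinite degree satisfies neither side: `pointDegree` is then the junk
value `0`. -/
lemma nonempty_residueEmbedding_iff (y : Y) :
    Nonempty (ResidueEmbedding g K y) ↔ pointDegree g y ∣ Module.finrank k K :=
  letI := residueAlgebra g y
  FiniteField.nonempty_algHom_iff_finrank_dvd (F := k) (K := Y.residueField y) (L := K)

lemma natCard_residueEmbedding (y : Y) (h : pointDegree g y ∣ Module.finrank k K) :
    Nat.card (ResidueEmbedding g K y) = pointDegree g y :=
  letI := residueAlgebra g y
  FiniteField.natCard_algHom_of_finrank_dvd (F := k) (K := Y.residueField y) (L := K) h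

variable {K} in
lemma isClosed_of_residueEmbedding [LocallyOfFiniteType g] {y : Y} (a : ResidueEmbedding g K y) :
    IsClosed {y} := by
  let := residueAlgebra g y
  rw [← residueField_finite_iff g]
  have : Finite (Y.residueField y) := Finite.of_injective _ (AlgHom.toRingHom a).injective
  exact Module.Finite.of_finite

/-- The pairs of a closed point of degree dividing `[K : k]` and an embedding of its residue
field into `K` are the `K`-valued points. -/
def closedEmbeddingEquiv [LocallyOfFiniteType g] :
    (Σ y : {y : closedPoints Y // pointDegree g y.1 ∣ Module.finrank k K},
      ResidueEmbedding g K y.1.1) ≃ Points g K :=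
  (show _ ≃ Σ y : Y, ResidueEmbedding g K y from
    { toFun := fun a => ⟨a.1.1.1, a.2⟩
      invFun := fun a => ⟨⟨⟨a.1, isClosed_of_residueEmbedding g a.2⟩,
        (nonempty_residueEmbedding_iff g K a.1).1 ⟨a.2⟩⟩, a.2⟩
      left_inv := fun _ => rfl
      right_inv := fun _ => rfl }).trans
  (Equiv.ofBijective _ (pointOfEmbedding_bijective g K))

lemma finite_closedPoints_dvd [LocallyOfFiniteType g] [Finite (Points g K)] :
    Finite {y : closedPoints Y // pointDegree g y.1 ∣ Module.finrank k K} := by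
  have (y : {y : closedPoints Y // pointDegree g y.1 ∣ Module.finrank k K}) :
      Nonempty (ResidueEmbedding g K y.1.1) := (nonempty_residueEmbedding_iff g K _).2 y.2
  exact Finite.of_injective (fun y => closedEmbeddingEquiv g K ⟨y, Classical.choice (this y)⟩)
    fun y z h => congr_arg Sigma.fst ((closedEmbeddingEquiv g K).injective h)

/-- Counting points through closed points: `#Y(K)` is the sum of the degrees of the closed points
whose degree divides `[K : k]`. -/
lemma natCard_points [LocallyOfFiniteType g] [Finite (Points g K)] :
    Nat.card (Points g K) =
      ∑' y : {y : closedPoints Y // pointDegree g y.1 ∣ Module.finrank k K},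
        pointDegree g y.1.1 := by
  have := finite_closedPoints_dvd g K
  have := Fintype.ofFinite {y : closedPoints Y // pointDegree g y.1 ∣ Module.finrank k K}
  have (y : {y : closedPoints Y // pointDegree g y.1 ∣ Module.finrank k K}) :
      Finite (ResidueEmbedding g K y.1.1) :=
    Nat.finite_of_card_ne_zero (by
      rw [natCard_residueEmbedding g K _ y.2]; exact (pointDegree_pos g y.1).ne')
  rw [← Nat.card_congr (closedEmbeddingEquiv g K), Nat.card_sigma, tsum_fintype]
  exact Finset.sum_congr rfl fun y _ => natCard_residueEmbedding g K _ y.2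

end FiniteField

end PointsOverField

/-! ### Uniform bounds for numbers of points -/

section Bound

/-- A ring generated by `n` elements has at most `#K ^ n` homomorphisms to a finite field `K`. -/
lemma exists_card_ringHom_bound (R : Type) [CommRing R] [Algebra.FiniteType ℤ R] :
    ∃ n : ℕ, ∀ (K : Type) [Field K] [Finite K], Finite (R →+* K) ∧
      Nat.card (R →+* K) ≤ Nat.card K ^ n := by
  obtain ⟨n, π, hπ⟩ := Algebra.FiniteType.iff_quotient_mvPolynomial''.1
    (inferInstance : Algebra.FiniteType ℤ R)
  refine ⟨n, fun K _ _ => ?_⟩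
  have hinj : Function.Injective fun (φ : R →+* K) (i : Fin n) => φ (π (MvPolynomial.X i)) := by
    intro φ ψ h
    have : φ.comp (π : MvPolynomial (Fin n) ℤ →+* R) = ψ.comp π :=
      MvPolynomial.ringHom_ext (fun z => by simp) fun i => congr_fun h i
    exact (RingHom.cancel_right hπ).1 this
  refine ⟨Finite.of_injective _ hinj, (Nat.card_le_card_of_injective _ hinj).trans ?_⟩
  rw [Nat.card_fun, Nat.card_eq_fintype_card (α := Fin n), Fintype.card_fin]

lemma exists_card_affine_bound (R : CommRingCat.{0}) (f : Spec R ⟶ Spec (.of ℤ))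
    [LocallyOfFiniteType f] :
    ∃ n : ℕ, ∀ (K : Type) [Field K] [Finite K], Finite (Spec (.of K) ⟶ Spec R) ∧
      Nat.card (Spec (.of K) ⟶ Spec R) ≤ Nat.card K ^ n := by
  obtain ⟨φ, rfl⟩ := Spec.map_surjective f
  have hφ : φ.hom.FiniteType := by
    rwa [HasRingHomProperty.Spec_iff (P := @LocallyOfFiniteType)] at *
  have : Algebra.FiniteType ℤ R := by
    rw [← RingHom.finiteType_algebraMap]
    convert! hφ
    exact RingHom.ext_int _ _
  obtain ⟨n, hn⟩ := exists_card_ringHom_bound R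
  refine ⟨n, fun K _ _ => ?_⟩
  let e : (R →+* K) ≃ (Spec (.of K) ⟶ Spec R) :=
    Equiv.ofBijective (fun ψ => Spec.map (CommRingCat.ofHom ψ))
      ⟨fun a b h => congr($(Spec.map_injective h).hom),
       fun h => ⟨(Spec.preimage h).hom, Spec.map_preimage h⟩⟩
  have := (hn K).1
  exact ⟨Finite.of_equiv _ e, (Nat.card_congr e).symm ▸ (hn K).2⟩

/-- A scheme of finite type over `ℤ` has at most `C * #K ^ n` points with values in a finite
field `K`, with `C` and `n` independent of `K`. -/
lemma exists_card_bound (X : Scheme.{0}) (f : X ⟶ Spec (.of ℤ))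
    [LocallyOfFiniteType f] [QuasiCompact f] :
    ∃ C n : ℕ, ∀ (K : Type) [Field K] [Finite K], Finite (Spec (.of K) ⟶ X) ∧
      Nat.card (Spec (.of K) ⟶ X) ≤ C * Nat.card K ^ n := by
  have : CompactSpace X := QuasiCompact.compactSpace_of_compactSpace f
  let 𝒰 := X.affineCover.finiteSubcover
  have hfin : Finite 𝒰.I₀ := inferInstance
  have h (i : 𝒰.I₀) : ∃ n : ℕ, ∀ (K : Type) [Field K] [Finite K],
      Finite (Spec (.of K) ⟶ 𝒰.X i) ∧ Nat.card (Spec (.of K) ⟶ 𝒰.X i) ≤ Nat.card K ^ n :=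
    @exists_card_affine_bound _ (𝒰.f i ≫ f) (locallyOfFiniteType_comp (𝒰.f i) f)
  choose n hn using h
  have := Fintype.ofFinite 𝒰.I₀
  refine ⟨Fintype.card 𝒰.I₀, Finset.univ.sup n, fun K _ _ => ?_⟩
  have := fun i => (hn i K).1
  -- a point with values in a field lands in a single member of the cover
  have hsurj : Function.Surjective
      fun a : Σ i, (Spec (.of K) ⟶ 𝒰.X i) => a.2 ≫ 𝒰.f a.1 := by
    intro φ
    obtain ⟨i, x, hx⟩ := 𝒰.exists_eq (φ (IsLocalRing.closedPoint K))
    have hrange : Set.range φ ⊆ Set.range (𝒰.f i) := by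
      rintro _ ⟨z, rfl⟩
      exact ⟨x, by rw [hx, Subsingleton.elim z (IsLocalRing.closedPoint K)]⟩
    exact ⟨⟨i, IsOpenImmersion.lift (𝒰.f i) φ hrange⟩, IsOpenImmersion.lift_fac _ _ _⟩
  refine ⟨Finite.of_surjective _ hsurj, (Nat.card_le_card_of_surjective _ hsurj).trans ?_⟩
  rw [Nat.card_sigma, ← Finset.card_univ, ← smul_eq_mul]
  exact Finset.sum_le_card_nsmul _ _ _ fun i _ => (hn i K).2.trans
    (Nat.pow_le_pow_right Nat.card_pos (Finset.le_sup (Finset.mem_univ i)))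

variable {X : Scheme.{0}} (f : X ⟶ Spec (.of ℤ))

/-- A `K`-valued point of `X_p` over `𝔽_p` is determined by its image in `X`. -/
lemma points_reduction_injective (p : ℕ) [Fact p.Prime] (K : Type) [Field K]
    [Algebra (ZMod p) K] :
    Function.Injective fun φ : Points (reductionMap f p) K => φ.1 ≫ pullback.fst f
      (Spec.map (CommRingCat.ofHom (Int.castRingHom (ZMod p)))) := by
  intro φ ψ h
  apply Subtype.ext
  exact pullback.hom_ext h (φ.2.trans ψ.2.symm)

instance [LocallyOfFiniteType f] (p : ℕ) : LocallyOfFiniteType (reductionMap f p) :=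
  inferInstanceAs (LocallyOfFiniteType (pullback.snd _ _))

/-- A scheme of finite type over `ℤ` has at most `C * p ^ (m * n)` points over the field with
`p ^ m` elements, with `C` and `n` independent of `p` and `m`. -/
lemma exists_pointCount_bound [LocallyOfFiniteType f] [QuasiCompact f] :
    ∃ C n : ℕ, ∀ (p : Nat.Primes) (m : ℕ+),
      Finite (Points (reductionMap f p) (GaloisField p m)) ∧
        pointCount (reductionMap f p) m ≤ C * (p ^ (m : ℕ)) ^ n := by
  obtain ⟨C, n, h⟩ := exists_card_bound X f
  refine ⟨C, n, fun p m => ?_⟩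
  have : Finite (GaloisField p m) := inferInstance
  obtain ⟨h1, h2⟩ := h (GaloisField p m)
  have hinj := points_reduction_injective f p (GaloisField p m)
  refine ⟨Finite.of_injective _ hinj, (Nat.card_le_card_of_injective _ hinj).trans ?_⟩
  rwa [GaloisField.card p m m.ne_zero] at h2

/-- `#Y(𝔽_{p^m})` is the sum of the degrees of the closed points of degree dividing `m`. -/
lemma pointCount_eq_tsum {p : ℕ} [Fact p.Prime] {Y : Scheme.{0}} (g : Y ⟶ Spec (.of (ZMod p)))
    [LocallyOfFiniteType g] (m : ℕ+) [Finite (Points g (GaloisField p m))] :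
    pointCount g m =
      ∑' y : {y : closedPoints Y // pointDegree g y.1 ∣ m}, pointDegree g y.1.1 := by
  have h := natCard_points g (GaloisField p m)
  rwa [GaloisField.finrank p m.ne_zero] at h

end Bound

/-! ### Dirichlet series with nonnegative coefficients -/

section Dirichlet

variable {ι : Type*} {c ℓ : ι → ℝ} {σ u : ℝ}

lemma summable_dirichlet_of_le (hc : ∀ i, 0 ≤ c i) (hℓ : ∀ i, 0 ≤ ℓ i)
    (h : Summable fun i => c i * Real.exp (-σ * ℓ i)) (hu : σ ≤ u) :
    Summable fun i => c i * Real.exp (-u * ℓ i) := by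
  refine h.of_nonneg_of_le (fun i => mul_nonneg (hc i) (Real.exp_pos _).le) fun i => ?_
  have := hℓ i
  have := hc i
  gcongr

/-- A factor `x` costs an arbitrarily small shift `δ` of the exponent, as `δ * x ≤ exp (δ * x)`. -/
lemma length_mul_exp_le {δ x : ℝ} (hδ : 0 < δ) (hx : 0 ≤ x) {v : ℝ} (hv : σ + δ ≤ v) :
    x * Real.exp (-v * x) ≤ δ⁻¹ * Real.exp (-σ * x) := by
  have h1 : δ * x ≤ Real.exp (δ * x) := by linarith [Real.add_one_le_exp (δ * x)]
  have h2 : x ≤ δ⁻¹ * Real.exp (δ * x) := by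
    rw [le_inv_mul_iff₀ hδ]
    exact h1
  calc x * Real.exp (-v * x) ≤ δ⁻¹ * Real.exp (δ * x) * Real.exp (-(σ + δ) * x) := by
        gcongr
    _ = δ⁻¹ * Real.exp (-σ * x) := by
        rw [mul_assoc, ← Real.exp_add]
        ring_nf

lemma summable_dirichlet_deriv (hc : ∀ i, 0 ≤ c i) (hℓ : ∀ i, 0 ≤ ℓ i)
    (h : Summable fun i => c i * Real.exp (-σ * ℓ i)) (hu : σ < u) :
    Summable fun i => c i * (ℓ i * Real.exp (-u * ℓ i)) := by
  refine (h.mul_left (u - σ)⁻¹).of_nonneg_of_le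
    (fun i => mul_nonneg (hc i) (mul_nonneg (hℓ i) (Real.exp_pos _).le)) fun i => ?_
  calc c i * (ℓ i * Real.exp (-u * ℓ i))
      ≤ c i * ((u - σ)⁻¹ * Real.exp (-σ * ℓ i)) :=
        mul_le_mul_of_nonneg_left (length_mul_exp_le (by linarith) (hℓ i) (by linarith)) (hc i)
    _ = _ := by ring

/-- A Dirichlet series `∑ c i * exp (-u * ℓ i)` with nonnegative coefficients and nonnegative
frequencies may be differentiated termwise to the right of a point of convergence. -/
lemma hasDerivAt_dirichlet (hc : ∀ i, 0 ≤ c i) (hℓ : ∀ i, 0 ≤ ℓ i)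
    (h : Summable fun i => c i * Real.exp (-σ * ℓ i)) (hu : σ < u) :
    HasDerivAt (fun v => ∑' i, c i * Real.exp (-v * ℓ i))
      (-∑' i, c i * (ℓ i * Real.exp (-u * ℓ i))) u := by
  -- uniform bounds hold on `(σ + δ, ∞)`, a neighbourhood of `u`
  set δ := (u - σ) / 2 with hδ
  have hδ0 : 0 < δ := by rw [hδ]; linarith
  rw [← tsum_neg]
  refine hasDerivAt_tsum_of_isPreconnected (u := fun i => δ⁻¹ * (c i * Real.exp (-σ * ℓ i)))
    (t := Set.Ioi (σ + δ)) (y₀ := u) (h.mul_left _) isOpen_Ioi isPreconnected_Ioi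
    (g' := fun i v => -(c i * (ℓ i * Real.exp (-v * ℓ i)))) ?_ ?_ ?_
    (summable_dirichlet_of_le hc hℓ h hu.le) ?_
  · intro i v _
    have h1 : HasDerivAt (fun v : ℝ => -v * ℓ i) (-1 * ℓ i) v :=
      (hasDerivAt_id v).neg.mul_const _
    have h2 := h1.exp.const_mul (c i)
    rwa [show c i * (Real.exp (-v * ℓ i) * (-1 * ℓ i)) = -(c i * (ℓ i * Real.exp (-v * ℓ i))) by
      ring] at h2
  · intro i v hv
    rw [norm_neg, Real.norm_of_nonneg (mul_nonneg (hc i) (mul_nonneg (hℓ i) (Real.exp_pos _).le))]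
    calc c i * (ℓ i * Real.exp (-v * ℓ i)) ≤ c i * (δ⁻¹ * Real.exp (-σ * ℓ i)) :=
          mul_le_mul_of_nonneg_left (length_mul_exp_le hδ0 (hℓ i) (le_of_lt hv)) (hc i)
      _ = _ := by ring
  all_goals (rw [Set.mem_Ioi, hδ]; linarith)

end Dirichlet

/-! ### Euler products over finitely supported multiplicities -/

section EulerProduct

variable {ι : Type*}

lemma sum_finsupp_prod_pow (w : ι → ℝ) (F : Finset ι) (N : ℕ) :
    ∑ α ∈ F.finsupp (fun _ => Finset.range N), (α.prod fun x n => w x ^ n) =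
      ∏ x ∈ F, ∑ n ∈ Finset.range N, w x ^ n := by
  classical
  rw [Finset.prod_sum, Finset.finsupp, Finset.sum_map]
  refine Finset.sum_congr rfl fun p _ => ?_
  simp only [Function.Embedding.coeFn_mk]
  rw [Finsupp.prod_of_support_subset _ (s := F) (Finsupp.support_indicator_subset _ _) _
    (fun _ _ => pow_zero _), ← Finset.prod_attach]
  exact Finset.prod_congr rfl fun x _ => by
    simp

/-- The Euler product: expanding `∏ (1 - w x)⁻¹` gives the sum over all finitely supported
exponents of the monomials in the `w x`. -/
lemma hasSum_finsupp_prod_pow {w : ι → ℝ} (h0 : ∀ x, 0 ≤ w x) (h1 : ∀ x, w x < 1) {S : ℝ}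
    (hS : HasSum (fun x => -Real.log (1 - w x)) S) :
    HasSum (fun α : ι →₀ ℕ => α.prod fun x n => w x ^ n) (Real.exp S) := by
  classical
  have hpos (x) : 0 < 1 - w x := sub_pos.2 (h1 x)
  have hlog (x) : 0 ≤ -Real.log (1 - w x) :=
    neg_nonneg.2 (Real.log_nonpos (hpos x).le (by linarith [h0 x]))
  have hprod (F : Finset ι) :
      ∏ x ∈ F, (1 - w x)⁻¹ = Real.exp (∑ x ∈ F, -Real.log (1 - w x)) := by
    rw [Real.exp_sum]
    exact Finset.prod_congr rfl fun x _ => by rw [Real.exp_neg, Real.exp_log (hpos x)]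
  have hnn (α : ι →₀ ℕ) : 0 ≤ α.prod fun x n => w x ^ n :=
    Finset.prod_nonneg fun x _ => pow_nonneg (h0 x) _
  refine hasSum_of_isLUB_of_nonneg _ hnn ⟨?_, ?_⟩
  · rintro _ ⟨A, rfl⟩
    -- every finite set of exponents lies in a box
    let F := A.sup Finsupp.support
    let N := A.sup (fun α => F.sup α) + 1
    have hA : A ⊆ F.finsupp fun _ => Finset.range N := by
      intro α hα
      have hF : α.support ⊆ F := Finset.le_sup (f := Finsupp.support) hα
      refine Finset.mem_finsupp_iff.2 ⟨hF, fun x hx => Finset.mem_range.2 ?_⟩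
      exact Nat.lt_succ_of_le ((Finset.le_sup (f := α) hx).trans
        (Finset.le_sup (f := fun α : ι →₀ ℕ => F.sup α) hα))
    calc ∑ α ∈ A, (α.prod fun x n => w x ^ n)
        ≤ ∑ α ∈ F.finsupp (fun _ => Finset.range N), (α.prod fun x n => w x ^ n) :=
          Finset.sum_le_sum_of_subset_of_nonneg hA fun α _ _ => hnn α
      _ = ∏ x ∈ F, ∑ n ∈ Finset.range N, w x ^ n := sum_finsupp_prod_pow w F N
      _ ≤ ∏ x ∈ F, (1 - w x)⁻¹ := by
          refine Finset.prod_le_prod (fun x _ => Finset.sum_nonneg fun n _ => pow_nonneg (h0 x) n)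
            fun x _ => ?_
          exact sum_le_hasSum _ (fun n _ => pow_nonneg (h0 x) n)
            (hasSum_geometric_of_lt_one (h0 x) (h1 x))
      _ ≤ Real.exp S := by
          rw [hprod]
          exact Real.exp_le_exp.2 (sum_le_hasSum _ (fun x _ => hlog x) hS)
  · intro b hb
    have hF (F : Finset ι) : Real.exp (∑ x ∈ F, -Real.log (1 - w x)) ≤ b := by
      rw [← hprod]
      refine le_of_tendsto (tendsto_finsetProd F fun x _ =>
        (hasSum_geometric_of_lt_one (h0 x) (h1 x)).tendsto_sum_nat)
        (Filter.Eventually.of_forall fun N => ?_)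
      rw [← sum_finsupp_prod_pow]
      exact hb ⟨_, rfl⟩
    exact le_of_tendsto ((Real.continuous_exp.tendsto S).comp hS)
      (Filter.Eventually.of_forall hF)

/-- The general term `exp (-u * ℓ x) ^ k / k` of the logarithm of the Euler product
`∏ (1 - exp (-u * ℓ x))⁻¹`. -/
def logEulerTerm (ℓ : ι → ℝ) (u : ℝ) (a : ι × ℕ+) : ℝ :=
  (a.2 : ℝ)⁻¹ * Real.exp (-u * (a.2 * ℓ a.1))

/-- The general term of minus the derivative of the logarithm of the Euler product. -/
def logEulerDeriv (ℓ : ι → ℝ) (u : ℝ) (a : ι × ℕ+) : ℝ :=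
  ℓ a.1 * Real.exp (-u * (a.2 * ℓ a.1))

/-- The length `∑ α x * ℓ x` of a finitely supported family of multiplicities, the elements of
`ι` having the lengths `ℓ x`. -/
def totalLength (ℓ : ι → ℝ) (α : ι →₀ ℕ) : ℝ := α.sum fun x n => n * ℓ x

lemma totalLength_nonneg {ℓ : ι → ℝ} (hℓ : ∀ x, 0 ≤ ℓ x) (α : ι →₀ ℕ) : 0 ≤ totalLength ℓ α :=
  Finset.sum_nonneg fun x _ => mul_nonneg (Nat.cast_nonneg _) (hℓ x)

lemma logEulerTerm_nonneg (ℓ : ι → ℝ) (u : ℝ) (a : ι × ℕ+) : 0 ≤ logEulerTerm ℓ u a :=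
  mul_nonneg (inv_nonneg.2 (Nat.cast_nonneg _)) (Real.exp_pos _).le

lemma logEulerDeriv_nonneg {ℓ : ι → ℝ} (hℓ : ∀ x, 0 ≤ ℓ x) (u : ℝ) (a : ι × ℕ+) :
    0 ≤ logEulerDeriv ℓ u a :=
  mul_nonneg (hℓ _) (Real.exp_pos _).le

lemma exp_neg_totalLength (ℓ : ι → ℝ) (u : ℝ) (α : ι →₀ ℕ) :
    Real.exp (-u * totalLength ℓ α) = α.prod fun x n => Real.exp (-u * ℓ x) ^ n := by
  rw [totalLength, Finsupp.sum, Finset.mul_sum, Real.exp_sum]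
  exact Finset.prod_congr rfl fun x _ => by
    simp only [← Real.exp_nat_mul]
    ring_nf

variable {ℓ : ι → ℝ} {σ u : ℝ}

/-- Convergence of the logarithm forces all local weights to be below `1`, since
`∑ y ^ k / k` dominates the harmonic series for `1 ≤ y`. -/
lemma exp_neg_lt_one_of_summable (h : Summable (logEulerTerm ℓ u)) (x : ι) :
    Real.exp (-u * ℓ x) < 1 := by
  by_contra! hx
  have hx0 : 0 ≤ -u * ℓ x := by simpa using hx
  have h1 : Summable fun k : ℕ+ => logEulerTerm ℓ u (x, k) :=
    h.comp_injective (Prod.mk_right_injective x)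
  have h2 : Summable fun k : ℕ+ => ((k : ℕ) : ℝ)⁻¹ := by
    refine h1.of_nonneg_of_le (fun k => by positivity) fun k => ?_
    refine le_mul_of_one_le_right (by positivity) (Real.one_le_exp ?_)
    rw [mul_left_comm]
    positivity
  exact Real.not_summable_natCast_inv
    ((summable_pnat_iff_summable_nat (f := fun n : ℕ => (n : ℝ)⁻¹)).1 h2)

lemma hasSum_logEulerTerm_fiber {x : ι} (hx : Real.exp (-u * ℓ x) < 1) :
    HasSum (fun k : ℕ+ => logEulerTerm ℓ u (x, k)) (-Real.log (1 - Real.exp (-u * ℓ x))) := by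
  have h := Real.hasSum_pow_div_log_of_abs_lt_one (x := Real.exp (-u * ℓ x))
    (by rwa [abs_of_pos (Real.exp_pos _)])
  rw [← Equiv.pnatEquivNat.hasSum_iff] at h
  convert h using 2 with k
  have hk : ((Equiv.pnatEquivNat k : ℕ) : ℝ) + 1 = (k : ℕ) := by
    rw [Equiv.pnatEquivNat_apply]
    exact_mod_cast PNat.natPred_add_one k
  have hk' : (Equiv.pnatEquivNat k : ℕ) + 1 = k := by exact_mod_cast hk
  simp only [Function.comp_apply, logEulerTerm]
  rw [hk, hk', ← Real.exp_nat_mul, div_eq_inv_mul]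
  ring_nf

/-- The Euler product in terms of lengths: its expansion into a Dirichlet series over finitely
supported multiplicities. -/
lemma hasSum_exp_totalLength (h : Summable (logEulerTerm ℓ u)) :
    HasSum (fun α : ι →₀ ℕ => Real.exp (-u * totalLength ℓ α))
      (Real.exp (∑' a, logEulerTerm ℓ u a)) := by
  simp_rw [exp_neg_totalLength]
  have hx := exp_neg_lt_one_of_summable h
  exact hasSum_finsupp_prod_pow (fun x => (Real.exp_pos _).le) hx
    (h.hasSum.prod_fiberwise fun x => hasSum_logEulerTerm_fiber (hx x))

lemma logEulerDeriv_eq (ℓ : ι → ℝ) (u : ℝ) : logEulerDeriv ℓ u =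
    fun a : ι × ℕ+ => (a.2 : ℝ)⁻¹ * (a.2 * ℓ a.1 * Real.exp (-u * (a.2 * ℓ a.1))) := by
  ext a
  have : (a.2 : ℝ) ≠ 0 := by exact_mod_cast a.2.ne_zero
  rw [logEulerDeriv]
  field_simp

lemma summable_logEulerTerm_of_le (hℓ : ∀ x, 0 ≤ ℓ x)
    (h : Summable (logEulerTerm ℓ σ)) (hu : σ ≤ u) : Summable (logEulerTerm ℓ u) :=
  summable_dirichlet_of_le (fun _ : ι × ℕ+ => inv_nonneg.2 (Nat.cast_nonneg _))
    (fun a => mul_nonneg (Nat.cast_nonneg _) (hℓ a.1)) h hu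

lemma summable_logEulerDeriv (hℓ : ∀ x, 0 ≤ ℓ x)
    (h : Summable (logEulerTerm ℓ σ)) (hu : σ < u) : Summable (logEulerDeriv ℓ u) := by
  rw [logEulerDeriv_eq]
  exact summable_dirichlet_deriv (fun _ : ι × ℕ+ => inv_nonneg.2 (Nat.cast_nonneg _))
    (fun a => mul_nonneg (Nat.cast_nonneg _) (hℓ a.1)) h hu

lemma hasDerivAt_tsum_logEulerTerm (hℓ : ∀ x, 0 ≤ ℓ x)
    (h : Summable (logEulerTerm ℓ σ)) (hu : σ < u) :
    HasDerivAt (fun v => ∑' a, logEulerTerm ℓ v a) (-∑' a, logEulerDeriv ℓ u a) u := by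
  rw [logEulerDeriv_eq]
  exact hasDerivAt_dirichlet (fun _ : ι × ℕ+ => inv_nonneg.2 (Nat.cast_nonneg _))
    (fun a => mul_nonneg (Nat.cast_nonneg _) (hℓ a.1)) h hu

/-- The mean length: both sides are minus the derivative of the Euler product, the left one of its
expansion as a Dirichlet series, the right one of the exponential of its logarithm. -/
lemma hasSum_totalLength_mul_exp (hℓ : ∀ x, 0 ≤ ℓ x)
    (h : Summable (logEulerTerm ℓ σ)) (hu : σ < u) :
    HasSum (fun α : ι →₀ ℕ => totalLength ℓ α * Real.exp (-u * totalLength ℓ α))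
      (Real.exp (∑' a, logEulerTerm ℓ u a) * ∑' a, logEulerDeriv ℓ u a) := by
  have hD : Summable fun α : ι →₀ ℕ => 1 * Real.exp (-σ * totalLength ℓ α) := by
    simpa using (hasSum_exp_totalLength h).summable
  have hs := summable_dirichlet_deriv (fun _ => zero_le_one) (totalLength_nonneg hℓ) hD hu
  have hd := hasDerivAt_dirichlet (fun _ => zero_le_one) (totalLength_nonneg hℓ) hD hu
  simp only [one_mul] at hs hd
  have he := (hasDerivAt_tsum_logEulerTerm hℓ h hu).exp
  have heq : (fun v => ∑' α : ι →₀ ℕ, Real.exp (-v * totalLength ℓ α)) =ᶠ[nhds u]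
      fun v => Real.exp (∑' a, logEulerTerm ℓ v a) := by
    filter_upwards [lt_mem_nhds hu] with v hv
    exact (hasSum_exp_totalLength (summable_logEulerTerm_of_le hℓ h hv.le)).tsum_eq
  have key := hd.unique (he.congr_of_eventuallyEq heq)
  rw [mul_neg, neg_inj] at key
  exact key ▸ hs.hasSum

end EulerProduct

/-! ### Rearrangement of nonnegative series and products -/

section Rearrangement

/-- Pairs of an element `y` and a multiple `k * deg y` of its degree. -/
def multipleEquiv {C : Type*} (deg : C → ℕ+) :
    C × ℕ+ ≃ Σ m : ℕ+, {y : C // (deg y : ℕ) ∣ m} :=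
  Equiv.ofBijective
    (fun a => ⟨a.2 * deg a.1, a.1, by rw [PNat.mul_coe]; exact dvd_mul_left _ _⟩) <| by
    constructor
    · rintro ⟨y, k⟩ ⟨z, l⟩ h
      obtain rfl : y = z :=
        congr_arg (fun t : Σ m : ℕ+, {y : C // (deg y : ℕ) ∣ m} => (t.2 : C)) h
      exact Prod.ext rfl (mul_right_cancel (congr_arg Sigma.fst h))
    · rintro ⟨m, y, hy⟩
      obtain ⟨k, hk⟩ := PNat.dvd_iff.2 hy
      exact ⟨(y, k), Sigma.subtype_ext ((mul_comm _ _).trans hk.symm) rfl⟩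

/-- If `N m` is the sum of the degrees dividing `m`, then a series with coefficients `N m` is a
series over the pairs of an element `y` and a multiple of its degree. -/
lemma summable_and_tsum_count_mul {C : Type*} (deg : C → ℕ+) {N : ℕ+ → ℕ} {c : ℕ+ → ℝ}
    (hfin : ∀ m : ℕ+, Finite {y : C // (deg y : ℕ) ∣ m})
    (hN : ∀ m : ℕ+, N m = ∑' y : {y : C // (deg y : ℕ) ∣ m}, (deg y.1 : ℕ))
    (hc : ∀ m, 0 ≤ c m) :
    ((Summable fun m => (N m : ℝ) * c m) ↔
      Summable fun a : C × ℕ+ => (deg a.1 : ℝ) * c (a.2 * deg a.1)) ∧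
    ∑' m, (N m : ℝ) * c m = ∑' a : C × ℕ+, (deg a.1 : ℝ) * c (a.2 * deg a.1) := by
  let G : (Σ m : ℕ+, {y : C // (deg y : ℕ) ∣ m}) → ℝ := fun t => (deg t.2.1 : ℝ) * c t.1
  have hG : (fun a : C × ℕ+ => (deg a.1 : ℝ) * c (a.2 * deg a.1)) = G ∘ multipleEquiv deg := rfl
  have hG0 (t) : 0 ≤ G t := mul_nonneg (Nat.cast_nonneg _) (hc _)
  have hfib (m : ℕ+) : ∑' y, G ⟨m, y⟩ = N m * c m := by
    have := hfin m
    have := Fintype.ofFinite {y : C // (deg y : ℕ) ∣ m}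
    rw [hN m, tsum_fintype, tsum_fintype, Nat.cast_sum, Finset.sum_mul]
  have hiff : Summable G ↔ Summable fun m => (N m : ℝ) * c m := by
    rw [summable_sigma_of_nonneg hG0]
    simp only [hfib]
    exact ⟨fun h => h.2, fun h => ⟨fun m => have := hfin m; Summable.of_finite, h⟩⟩
  rw [hG, (multipleEquiv deg).summable_iff, hiff]
  refine ⟨Iff.rfl, ?_⟩
  rw [show ∑' a, (G ∘ multipleEquiv deg) a = ∑' t, G t from (multipleEquiv deg).tsum_eq G]
  by_cases h : Summable G
  · rw [h.tsum_sigma]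
    simp only [hfib]
  · rw [tsum_eq_zero_of_not_summable h, tsum_eq_zero_of_not_summable (hiff.not.1 h)]

lemma summable_sigma_prod_iff {ι : Type*} {C : ι → Type*} {F : (Σ i, C i) × ℕ+ → ℝ}
    (hF : ∀ a, 0 ≤ F a) :
    Summable F ↔ (∀ i, Summable fun a : C i × ℕ+ => F (⟨i, a.1⟩, a.2)) ∧
      Summable fun i => ∑' a : C i × ℕ+, F (⟨i, a.1⟩, a.2) := by
  rw [← (Equiv.sigmaProdDistrib C ℕ+).symm.summable_iff]
  exact summable_sigma_of_nonneg fun t => hF ((Equiv.sigmaProdDistrib C ℕ+).symm t)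

lemma tsum_sigma_prod {ι : Type*} {C : ι → Type*} {F : (Σ i, C i) × ℕ+ → ℝ} (h : Summable F) :
    ∑' a, F a = ∑' i, ∑' a : C i × ℕ+, F (⟨i, a.1⟩, a.2) := by
  rw [← (Equiv.sigmaProdDistrib C ℕ+).symm.tsum_eq]
  exact ((Equiv.sigmaProdDistrib C ℕ+).symm.summable_iff.2 h).tsum_sigma

/-- Unconditional convergence of a product of exponentials of nonnegative numbers. The limit
cannot be `0`, since all the finite products are at least `1`. -/
lemma multipliable_exp_iff {ι : Type*} {a : ι → ℝ} (ha : ∀ i, 0 ≤ a i) :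
    Multipliable (fun i => Real.exp (a i)) ↔ Summable a := by
  refine ⟨fun ⟨P, hP⟩ => ?_, fun h => h.hasSum.rexp.multipliable⟩
  have hle (F : Finset ι) : Real.exp (∑ i ∈ F, a i) ≤ P := by
    have hmono : Monotone fun F : Finset ι => ∏ i ∈ F, Real.exp (a i) := by
      intro F G h
      simp only [← Real.exp_sum]
      exact Real.exp_le_exp.2 (Finset.sum_le_sum_of_subset_of_nonneg h fun i _ _ => ha i)
    rw [Real.exp_sum]
    exact hmono.ge_of_tendsto hP F
  refine summable_of_sum_le ha (c := Real.log P) fun F => ?_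
  rw [Real.le_log_iff_exp_le ((Real.exp_pos _).trans_le (hle F))]
  exact hle F

end Rearrangement

/-! ### Zeta functions as Euler products over closed points -/

section Scheme

variable {X : Scheme.{0}} (f : X ⟶ Spec (.of ℤ))

/-- The length `log (p ^ deg y)` of a closed point `y` of `X_p`. -/
def localLength (p : Nat.Primes) (y : closedPoints (reduction f p)) : ℝ :=
  pointDegree (reductionMap f p) y.1 * Real.log p

/-- The length `log (p ^ deg y)` of a closed point `y` of a reduction `X_p`, as a function
on the disjoint union over `p`. Families of zero-cycles on the `X_p`, almost all zero, are the
finitely supported multiplicities on this union. -/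
def pointLength (y : Σ p : Nat.Primes, closedPoints (reduction f p)) : ℝ :=
  localLength f y.1 y.2

lemma localLength_nonneg (p : Nat.Primes) (y : closedPoints (reduction f p)) :
    0 ≤ localLength f p y :=
  mul_nonneg (Nat.cast_nonneg _) (Real.log_natCast_nonneg p)

lemma pointLength_nonneg (y : Σ p : Nat.Primes, closedPoints (reduction f p)) :
    0 ≤ pointLength f y :=
  localLength_nonneg f y.1 y.2

lemma prime_rpow_eq_exp (p : Nat.Primes) (x : ℝ) : (p : ℝ) ^ x = Real.exp (Real.log p * x) :=
  Real.rpow_def_of_pos (by exact_mod_cast p.2.pos) x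

lemma logZetaTerm_nonneg (s : ℝ) (p : Nat.Primes) (m : ℕ+) :
    0 ≤ logZetaTerm (reductionMap f p) ((p : ℝ) ^ (-s)) m := by
  unfold logZetaTerm
  positivity

lemma totalLength_localLength (p : Nat.Primes) (α : EffZeroCycle (reduction f p)) :
    totalLength (localLength f p) α = cycleDegree (reductionMap f p) α * Real.log p := by
  simp only [totalLength, cycleDegree, localLength, Finsupp.sum, Nat.cast_sum, Finset.sum_mul,
    Nat.cast_mul, mul_assoc]

lemma rpow_pow_cycleDegree (s : ℝ) (p : Nat.Primes) (α : EffZeroCycle (reduction f p)) :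
    ((p : ℝ) ^ (-s)) ^ cycleDegree (reductionMap f p) α =
      Real.exp (-s * totalLength (localLength f p) α) := by
  rw [totalLength_localLength, prime_rpow_eq_exp, ← Real.exp_nat_mul]
  ring_nf

lemma infoTerm_eq (s : ℝ) (p : Nat.Primes) (α : EffZeroCycle (reduction f p)) :
    infoTerm (reductionMap f p) ((p : ℝ) ^ (-s)) α =
      s * (totalLength (localLength f p) α *
        Real.exp (-s * totalLength (localLength f p) α)) := by
  rw [infoTerm, rpow_pow_cycleDegree, Real.log_exp]
  ring

/-- The length of a family of zero-cycles on the reductions, seen as multiplicities on the disjoint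
union of their closed points, is the sum of the lengths of its members. -/
lemma totalLength_pointLength (α : Π₀ p : Nat.Primes, EffZeroCycle (reduction f p)) :
    HasSum (fun p => totalLength (localLength f p) (α p))
      (totalLength (pointLength f) (sigmaFinsuppEquivDFinsupp.symm α)) := by
  obtain ⟨β, rfl⟩ := sigmaFinsuppEquivDFinsupp.surjective α
  rw [Equiv.symm_apply_apply]
  have h : totalLength (pointLength f) β = ∑ p ∈ β.splitSupport,
      totalLength (localLength f p) (sigmaFinsuppEquivDFinsupp β p) := by
    rw [totalLength, Finsupp.sigma_sum]
    rfl
  rw [h]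
  refine hasSum_sum_of_ne_finset_zero fun p hp => ?_
  have : sigmaFinsuppEquivDFinsupp β p = 0 :=
    not_not.1 fun h => hp ((Finsupp.mem_splitSupport_iff_nonzero β p).2 h)
  rw [this]
  exact Finsupp.sum_zero_index

lemma summable_logEulerTerm_localLength {f : X ⟶ Spec (.of ℤ)} {s : ℝ}
    (h : Summable (logEulerTerm (pointLength f) s)) (p : Nat.Primes) :
    Summable (logEulerTerm (localLength f p) s) :=
  ((summable_sigma_prod_iff (logEulerTerm_nonneg _ _)).1 h).1 p

lemma hasSum_tsum_logEulerTerm_localLength {f : X ⟶ Spec (.of ℤ)} {s : ℝ}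
    (h : Summable (logEulerTerm (pointLength f) s)) :
    HasSum (fun p => ∑' a, logEulerTerm (localLength f p) s a)
      (∑' a, logEulerTerm (pointLength f) s a) := by
  rw [tsum_sigma_prod h]
  exact ((summable_sigma_prod_iff (logEulerTerm_nonneg _ _)).1 h).2.hasSum

lemma hasSum_tsum_logEulerDeriv_localLength {f : X ⟶ Spec (.of ℤ)} {σ s : ℝ}
    (h : Summable (logEulerTerm (pointLength f) σ)) (hs : σ < s) :
    HasSum (fun p => ∑' a, logEulerDeriv (localLength f p) s a)
      (∑' a, logEulerDeriv (pointLength f) s a) := by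
  have hD := summable_logEulerDeriv (pointLength_nonneg f) h hs
  rw [tsum_sigma_prod hD]
  exact ((summable_sigma_prod_iff (logEulerDeriv_nonneg (pointLength_nonneg f) _)).1 hD).2.hasSum

variable [LocallyOfFiniteType f]

/-- The degree of a closed point, as a positive integer. -/
def closedDegree (p : Nat.Primes) (y : closedPoints (reduction f p)) : ℕ+ :=
  ⟨pointDegree (reductionMap f p) y.1, pointDegree_pos _ y⟩

variable [QuasiCompact f]

lemma finite_points (p : Nat.Primes) (m : ℕ+) :
    Finite (Points (reductionMap f p) (GaloisField p m)) :=
  let ⟨_, _, h⟩ := exists_pointCount_bound f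
  (h p m).1

/-- A series over `m` with the numbers of points as coefficients, as a series over the pairs of a
closed point `y` and a multiple `k * deg y` of its degree. -/
lemma summable_and_tsum_pointCount_mul (p : Nat.Primes) {c : ℕ+ → ℝ} (hc : ∀ m, 0 ≤ c m) :
    ((Summable fun m : ℕ+ => (pointCount (reductionMap f p) m : ℝ) * c m) ↔
      Summable fun a : closedPoints (reduction f p) × ℕ+ =>
        (closedDegree f p a.1 : ℝ) * c (a.2 * closedDegree f p a.1)) ∧
    ∑' m : ℕ+, (pointCount (reductionMap f p) m : ℝ) * c m =
      ∑' a : closedPoints (reduction f p) × ℕ+,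
        (closedDegree f p a.1 : ℝ) * c (a.2 * closedDegree f p a.1) := by
  have hp := finite_points f p
  refine summable_and_tsum_count_mul (closedDegree f p)
    (N := fun m => pointCount (reductionMap f p) m) (fun m => ?_) (fun m => ?_) hc
  · have h := finite_closedPoints_dvd (reductionMap f p) (GaloisField p m)
    rwa [GaloisField.finrank p m.ne_zero] at h
  · exact pointCount_eq_tsum (reductionMap f p) m

/-- The series in the exponent of the zeta function is the logarithm of the Euler product over the
closed points. The equality of the sums needs no convergence, since both sums are the junk value `0`
when one of the series diverges. -/
lemma summable_and_tsum_logZetaTerm (s : ℝ) (p : Nat.Primes) :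
    (Summable (logZetaTerm (reductionMap f p) ((p : ℝ) ^ (-s))) ↔
      Summable (logEulerTerm (localLength f p) s)) ∧
    ∑' m, logZetaTerm (reductionMap f p) ((p : ℝ) ^ (-s)) m =
      ∑' a, logEulerTerm (localLength f p) s a := by
  have h := summable_and_tsum_pointCount_mul f p
    (c := fun m => (m : ℝ)⁻¹ * ((p : ℝ) ^ (-s)) ^ (m : ℕ)) fun m => by positivity
  have h1 : logZetaTerm (reductionMap f p) ((p : ℝ) ^ (-s)) = fun m : ℕ+ =>
      (pointCount (reductionMap f p) m : ℝ) * ((m : ℝ)⁻¹ * ((p : ℝ) ^ (-s)) ^ (m : ℕ)) := by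
    ext m
    rw [logZetaTerm, div_eq_mul_inv, mul_assoc]
  have h2 : logEulerTerm (localLength f p) s = fun a : closedPoints (reduction f p) × ℕ+ =>
      (closedDegree f p a.1 : ℝ) * (((a.2 * closedDegree f p a.1 : ℕ+) : ℝ)⁻¹ *
        ((p : ℝ) ^ (-s)) ^ ((a.2 * closedDegree f p a.1 : ℕ+) : ℕ)) := by
    ext ⟨y, k⟩
    have hd : ((closedDegree f p y : ℕ) : ℝ) ≠ 0 := by exact_mod_cast (closedDegree f p y).ne_zero
    have hl : localLength f p y = (closedDegree f p y : ℕ) * Real.log p := rfl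
    have hk : ((k : ℕ) : ℝ) ≠ 0 := by exact_mod_cast k.ne_zero
    simp only [logEulerTerm]
    rw [prime_rpow_eq_exp, ← Real.exp_nat_mul, hl, PNat.mul_coe, Nat.cast_mul, mul_inv,
      show -s * ((k : ℕ) * ((closedDegree f p y : ℕ) * Real.log p)) =
        (k : ℕ) * (closedDegree f p y : ℕ) * (Real.log p * -s) by ring]
    field_simp
  rw [h1, h2]
  exact h

lemma summable_and_tsum_ghostTerm (s : ℝ) (p : Nat.Primes) :
    (Summable (ghostTerm f s p) ↔ Summable (logEulerDeriv (localLength f p) s)) ∧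
    Real.log p * ∑' m, ghostTerm f s p m = ∑' a, logEulerDeriv (localLength f p) s a := by
  have hp : Real.log p ≠ 0 := (Real.log_pos (by exact_mod_cast p.2.one_lt)).ne'
  have h := summable_and_tsum_pointCount_mul f p
    (c := fun m => (p : ℝ) ^ (-s * (m : ℝ))) fun m => by positivity
  have h2 : logEulerDeriv (localLength f p) s = fun a : closedPoints (reduction f p) × ℕ+ =>
      Real.log p * ((closedDegree f p a.1 : ℝ) *
        (p : ℝ) ^ (-s * ((a.2 * closedDegree f p a.1 : ℕ+) : ℝ))) := by
    ext ⟨y, k⟩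
    have hl : localLength f p y = (closedDegree f p y : ℕ) * Real.log p := rfl
    simp only [logEulerDeriv]
    rw [prime_rpow_eq_exp, hl, PNat.mul_coe, Nat.cast_mul]
    ring_nf
  rw [h2, summable_mul_left_iff hp, tsum_mul_left]
  exact ⟨h.1, congr_arg _ h.2⟩

lemma localFactor_eq (s : ℝ) (p : Nat.Primes) :
    localFactor f s p = Real.exp (∑' a, logEulerTerm (localLength f p) s a) := by
  rw [localFactor, zeta, (summable_and_tsum_logZetaTerm f s p).2]

/-- Convergence of the `L`-function is convergence of a single series of nonnegative terms, over
all closed points of all reductions and all `k ≥ 1`. -/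
lemma lConverges_iff (s : ℝ) :
    LConverges f s ↔ Summable (logEulerTerm (pointLength f) s) := by
  rw [summable_sigma_prod_iff (logEulerTerm_nonneg _ _), LConverges]
  refine and_congr (forall_congr' fun p => (summable_and_tsum_logZetaTerm f s p).1) ?_
  rw [show localFactor f s = fun p => Real.exp (∑' a, logEulerTerm (localLength f p) s a) from
    funext (localFactor_eq f s),
    multipliable_exp_iff fun p => tsum_nonneg (logEulerTerm_nonneg _ _)]
  rfl

end Scheme

/-! ### The `L`-function and the entropy -/

section Global

variable {X : Scheme.{0}} (f : X ⟶ Spec (.of ℤ)) [LocallyOfFiniteType f] [QuasiCompact f]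

/-- A scheme of finite type over `ℤ` has a convergent `L`-function far to the right: with
`#X_p(𝔽_{p^m}) ≤ C * p ^ (m * n)` for all `p` and `m`, every `s > n + 1` will do. -/
lemma exists_lConverges : ∃ σ₀ : ℝ, ∀ s : ℝ, σ₀ < s → LConverges f s := by
  obtain ⟨C, n, hC⟩ := exists_pointCount_bound f
  refine ⟨n + 1, fun s hs => ?_⟩
  -- the bound for the local series is geometric with ratio `p ^ (n - s) ≤ 1 / 2`
  have hq (p : Nat.Primes) : (p : ℝ) ^ ((n : ℝ) - s) ≤ 1 / 2 := by
    have h2 : (2 : ℝ) ≤ p := by exact_mod_cast p.2.two_le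
    calc (p : ℝ) ^ ((n : ℝ) - s) ≤ (p : ℝ) ^ (-1 : ℝ) :=
          Real.rpow_le_rpow_of_exponent_le (by linarith) (by linarith)
      _ ≤ 1 / 2 := by
          rw [Real.rpow_neg_one, one_div]
          exact inv_anti₀ two_pos h2
  have hq0 (p : Nat.Primes) : 0 ≤ (p : ℝ) ^ ((n : ℝ) - s) :=
    Real.rpow_nonneg (Nat.cast_nonneg _) _
  have hgeom (p : Nat.Primes) : HasSum
      (fun m : ℕ+ => (C : ℝ) * ((p : ℝ) ^ ((n : ℝ) - s)) ^ (m : ℕ))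
      (C * ((p : ℝ) ^ ((n : ℝ) - s) * (1 - (p : ℝ) ^ ((n : ℝ) - s))⁻¹)) := by
    have h := ((hasSum_geometric_of_lt_one (hq0 p) (by linarith [hq p])).mul_left
      ((p : ℝ) ^ ((n : ℝ) - s))).mul_left (C : ℝ)
    rw [← Equiv.pnatEquivNat.hasSum_iff] at h
    refine h.congr_fun fun m => ?_
    rw [Function.comp_apply, Equiv.pnatEquivNat_apply, ← pow_succ', PNat.natPred_add_one]
  have hterm (p : Nat.Primes) (m : ℕ+) : logZetaTerm (reductionMap f p) ((p : ℝ) ^ (-s)) m ≤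
      C * ((p : ℝ) ^ ((n : ℝ) - s)) ^ (m : ℕ) := by
    have hp : (0 : ℝ) < p := by exact_mod_cast p.2.pos
    have hm : (1 : ℝ) ≤ (m : ℕ) := by exact_mod_cast m.pos
    have hcount : (pointCount (reductionMap f p) m : ℝ) ≤ C * ((p : ℝ) ^ (m : ℕ)) ^ n := by
      exact_mod_cast (hC p m).2
    calc logZetaTerm (reductionMap f p) ((p : ℝ) ^ (-s)) m
        ≤ C * ((p : ℝ) ^ (m : ℕ)) ^ n * ((p : ℝ) ^ (-s)) ^ (m : ℕ) := by
          refine mul_le_mul_of_nonneg_right ?_ (by positivity)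
          exact (div_le_self (Nat.cast_nonneg _) hm).trans hcount
      _ = C * ((p : ℝ) ^ ((n : ℝ) - s)) ^ (m : ℕ) := by
          rw [sub_eq_add_neg, Real.rpow_add hp, Real.rpow_natCast, mul_pow, ← pow_mul, ← pow_mul,
            mul_comm n, mul_assoc]
  have hlocal (p : Nat.Primes) :
      Summable (logZetaTerm (reductionMap f p) ((p : ℝ) ^ (-s))) :=
    (hgeom p).summable.of_nonneg_of_le (logZetaTerm_nonneg f s p) (hterm p)
  refine ⟨hlocal, ?_⟩
  have hsum : Summable fun p : Nat.Primes => (C : ℝ) * (2 * (p : ℝ) ^ ((n : ℝ) - s)) :=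
    ((Nat.Primes.summable_rpow.2 (by linarith)).mul_left 2).mul_left _
  refine (multipliable_exp_iff fun p => tsum_nonneg (logZetaTerm_nonneg f s p)).2
    (hsum.of_nonneg_of_le (fun p => tsum_nonneg (logZetaTerm_nonneg f s p)) fun p => ?_)
  refine ((hlocal p).tsum_le_tsum (hterm p) (hgeom p).summable).trans ?_
  rw [(hgeom p).tsum_eq, mul_comm (2 : ℝ)]
  have h2 : (1 - (p : ℝ) ^ ((n : ℝ) - s))⁻¹ ≤ 2 :=
    inv_le_of_inv_le₀ two_pos (by linarith [hq p])
  have := hq0 p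
  gcongr

variable {f} {s : ℝ}

lemma lFun_eq (h : Summable (logEulerTerm (pointLength f) s)) :
    LFun f s = Real.exp (∑' a, logEulerTerm (pointLength f) s a) := by
  rw [LFun, show localFactor f s = _ from funext (localFactor_eq f s)]
  exact (hasSum_tsum_logEulerTerm_localLength h).rexp.tprod_eq

/-- The distribution is `P(α) = exp (-s * length α) / L(X, s)`. -/
lemma globalDist_eq (h : Summable (logEulerTerm (pointLength f) s))
    (α : Π₀ p : Nat.Primes, EffZeroCycle (reduction f p)) :
    globalDist f s α =
      Real.exp (-s * totalLength (pointLength f) (sigmaFinsuppEquivDFinsupp.symm α) -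
        ∑' a, logEulerTerm (pointLength f) s a) := by
  have h1 := (((totalLength_pointLength f α).mul_left (-s)).sub
    (hasSum_tsum_logEulerTerm_localLength h)).rexp
  rw [globalDist, ← h1.tprod_eq]
  refine tprod_congr fun p => ?_
  rw [localDist, rpow_pow_cycleDegree, Function.comp_apply, Real.exp_sub, ← localFactor_eq f s p,
    localFactor]

lemma hasSum_globalDist (h : Summable (logEulerTerm (pointLength f) s)) :
    HasSum (globalDist f s) 1 := by
  have h1 := (hasSum_exp_totalLength h).mul_right
    (Real.exp (-∑' a, logEulerTerm (pointLength f) s a))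
  rw [← Real.exp_add, add_neg_cancel, Real.exp_zero,
    ← sigmaFinsuppEquivDFinsupp.symm.hasSum_iff] at h1
  refine h1.congr_fun fun α => ?_
  rw [globalDist_eq h, sub_eq_add_neg, Real.exp_add, Function.comp_apply]

variable {σ : ℝ}

/-- The entropy is the mean of `-log P = s * length + log L`. -/
lemma hasSum_globalDist_mul_log (h : Summable (logEulerTerm (pointLength f) σ)) (hs : σ < s) :
    HasSum (fun α => globalDist f s α * Real.log (globalDist f s α))
      (-(∑' a, logEulerTerm (pointLength f) s a +
        s * ∑' a, logEulerDeriv (pointLength f) s a)) := by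
  have hs' := summable_logEulerTerm_of_le (pointLength_nonneg f) h hs.le
  set T := ∑' a, logEulerTerm (pointLength f) s a with hT
  set D := ∑' a, logEulerDeriv (pointLength f) s a with hD
  have h1 := (hasSum_totalLength_mul_exp (pointLength_nonneg f) h hs).mul_left (-s * Real.exp (-T))
  rw [← sigmaFinsuppEquivDFinsupp.symm.hasSum_iff] at h1
  have h2 := h1.sub ((hasSum_globalDist hs').mul_left T)
  have h3 : -s * Real.exp (-T) * (Real.exp T * D) - T * 1 = -(T + s * D) := by
    rw [show -s * Real.exp (-T) * (Real.exp T * D) = -s * (Real.exp (-T) * Real.exp T) * D by ring,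
      ← Real.exp_add, neg_add_cancel, Real.exp_zero]
    ring
  rw [← hT, ← hD, h3] at h2
  refine h2.congr_fun fun α => ?_
  rw [globalDist_eq hs', Real.log_exp, ← hT, Function.comp_apply, sub_eq_add_neg _ T, Real.exp_add]
  ring

lemma hasSum_infoTerm (h : Summable (logEulerTerm (pointLength f) σ)) (hs : σ < s)
    (p : Nat.Primes) :
    HasSum (infoTerm (reductionMap f p) ((p : ℝ) ^ (-s)))
      (s * (localFactor f s p * ∑' a, logEulerDeriv (localLength f p) s a)) := by
  rw [localFactor_eq f s p]
  exact ((hasSum_totalLength_mul_exp (localLength_nonneg f p)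
    (summable_logEulerTerm_localLength h p) hs).mul_left s).congr_fun (infoTerm_eq f s p)

lemma localInfo_eq (h : Summable (logEulerTerm (pointLength f) σ)) (hs : σ < s)
    (p : Nat.Primes) :
    localInfo f s p = s * ∑' a, logEulerDeriv (localLength f p) s a := by
  have hne : localFactor f s p ≠ 0 := by
    rw [localFactor_eq]
    exact (Real.exp_pos _).ne'
  rw [localInfo, infoFun, (hasSum_infoTerm h hs p).tsum_eq]
  field_simp

lemma hasDerivAt_log_lFun (h : Summable (logEulerTerm (pointLength f) σ)) (hs : σ < s) :
    HasDerivAt (fun u => Real.log (LFun f u)) (-∑' a, logEulerDeriv (pointLength f) s a) s := by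
  refine (hasDerivAt_tsum_logEulerTerm (pointLength_nonneg f) h hs).congr_of_eventuallyEq ?_
  filter_upwards [lt_mem_nhds hs] with v hv
  rw [lFun_eq (summable_logEulerTerm_of_le (pointLength_nonneg f) h hv.le), Real.log_exp]

end Global

end

end HasseWeil

theorem proposition2p3 (X : Scheme.{0}) (f : X ⟶ Spec (.of ℤ))
    [LocallyOfFiniteType f] [QuasiCompact f] :
    -- the `L`-function converges on a right half-line
    (∃ σ₀ : ℝ, ∀ s : ℝ, σ₀ < s → HasseWeil.LConverges f s) ∧
    -- for every `s` to the right of a point of convergence: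
    ∀ s : ℝ, (∃ σ : ℝ, σ < s ∧ HasseWeil.LConverges f σ) →
      -- the distribution is a probability distribution, and the entropy series converges
      ((∀ α, 0 ≤ HasseWeil.globalDist f s α) ∧
        HasSum (HasseWeil.globalDist f s) 1 ∧
        Summable (fun α => HasseWeil.globalDist f s α * Real.log (HasseWeil.globalDist f s α))) ∧
      -- the entropy is the sum of the normalized information functions and of the `log Z(X_p)`
      ((∀ p : Nat.Primes,
          Summable (HasseWeil.infoTerm (HasseWeil.reductionMap f p) ((p : ℝ) ^ (-s)))) ∧
        Summable (HasseWeil.localInfo f s) ∧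
        Summable (fun p : Nat.Primes => Real.log (HasseWeil.localFactor f s p)) ∧
        HasseWeil.globalEntropy f s =
          (∑' p : Nat.Primes, HasseWeil.localInfo f s p) +
            (∑' p : Nat.Primes, Real.log (HasseWeil.localFactor f s p))) ∧
      -- the closed formula
      ((∀ p : Nat.Primes, Summable (HasseWeil.ghostTerm f s p)) ∧
        Summable (fun p : Nat.Primes => Real.log p * ∑' m : ℕ+, HasseWeil.ghostTerm f s p m) ∧
        HasseWeil.LConverges f s ∧ 0 < HasseWeil.LFun f s ∧
        HasseWeil.globalEntropy f s =
          Real.log (HasseWeil.LFun f s) +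
            s * (∑' p : Nat.Primes, Real.log p * (∑' m : ℕ+, HasseWeil.ghostTerm f s p m))) ∧
      -- the formula through the logarithmic derivative
      (DifferentiableAt ℝ (fun u => Real.log (HasseWeil.LFun f u)) s ∧
        s * (∑' p : Nat.Primes, Real.log p * (∑' m : ℕ+, HasseWeil.ghostTerm f s p m)) =
          -(s * deriv (fun u => Real.log (HasseWeil.LFun f u)) s) ∧
        HasseWeil.globalEntropy f s =
          Real.log (HasseWeil.LFun f s) - s * deriv (fun u => Real.log (HasseWeil.LFun f u)) s) :=
  by
  refine ⟨HasseWeil.exists_lConverges f, ?_⟩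
  rintro s ⟨σ, hs, hσ⟩
  have h := (HasseWeil.lConverges_iff f σ).1 hσ
  -- `T` is `log L(X, s)` and `D` is minus its derivative
  have hs' := HasseWeil.summable_logEulerTerm_of_le (HasseWeil.pointLength_nonneg f) h hs.le
  set T := ∑' a, HasseWeil.logEulerTerm (HasseWeil.pointLength f) s a with hT
  set D := ∑' a, HasseWeil.logEulerDeriv (HasseWeil.pointLength f) s a with hD
  have hlog := HasseWeil.hasSum_tsum_logEulerTerm_localLength hs'
  have hlogF : (fun p : Nat.Primes => Real.log (HasseWeil.localFactor f s p)) =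
      fun p => ∑' a, HasseWeil.logEulerTerm (HasseWeil.localLength f p) s a :=
    funext fun p => by rw [HasseWeil.localFactor_eq f s p, Real.log_exp]
  have hder := HasseWeil.hasSum_tsum_logEulerDeriv_localLength h hs
  have hghost : (fun p : Nat.Primes => Real.log p * ∑' m, HasseWeil.ghostTerm f s p m) =
      fun p => ∑' a, HasseWeil.logEulerDeriv (HasseWeil.localLength f p) s a :=
    funext fun p => (HasseWeil.summable_and_tsum_ghostTerm f s p).2
  have hinfo : HasseWeil.localInfo f s =
      fun p => s * ∑' a, HasseWeil.logEulerDeriv (HasseWeil.localLength f p) s a :=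
    funext (HasseWeil.localInfo_eq h hs)
  have hentropy := HasseWeil.hasSum_globalDist_mul_log h hs
  have hS : HasseWeil.globalEntropy f s = T + s * D := by
    rw [HasseWeil.globalEntropy, HasseWeil.shannonEntropy, hentropy.tsum_eq, neg_neg]
  have hL := HasseWeil.lFun_eq hs'
  have hd := HasseWeil.hasDerivAt_log_lFun h hs
  rw [hghost, hlogF, hinfo, tsum_mul_left, hder.tsum_eq, hlog.tsum_eq, hd.deriv, hS, hL,
    Real.log_exp, ← hT, ← hD]
  refine ⟨⟨fun α => ?_, HasseWeil.hasSum_globalDist hs', hentropy.summable⟩,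
    ⟨fun p => (HasseWeil.hasSum_infoTerm h hs p).summable, hder.summable.mul_left s,
      hlog.summable, add_comm _ _⟩,
    ⟨fun p => ?_, hder.summable, (HasseWeil.lConverges_iff f s).2 hs', Real.exp_pos _, rfl⟩,
    hd.differentiableAt, by ring, by ring⟩
  · rw [HasseWeil.globalDist_eq hs']
    exact (Real.exp_pos _).le
  · exact (HasseWeil.summable_and_tsum_ghostTerm f s p).1.2
      (HasseWeil.summable_logEulerDeriv (HasseWeil.localLength_nonneg f p)
        (HasseWeil.summable_logEulerTerm_localLength h p) hs)
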